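/- Rings and algebras are associative but not necessarily unital. Let $E=(E^0,E^1,\mathbf s,\mathbf r)$ be an arbitrary directed graph (no restriction on cardinality) and let $K$ be a field with an involution $*$ (any involution, possibly the identity). A vertex $v$ is regular if $\mathbf s^{-1}(v)$ is nonempty and finite; $R(E)$ denotes the set of regular vertices. For $S\subseteq R(E)$, the Cohn-Leavitt algebra $CL_K(E,S)$ is the free $K$-algebra generated by $E^0\cup E^1\cup\{e^*\mid e\in E^1\}$ subject to the relations, for all vertices $v,w$ and edges $e,f$, - (V) $vw=\delta_{v,w}v$, - (E1) $\mathbf s(e)e=e\,\mathbf r(e)=e$, - (E2) $\mathbf r(e)e^*=e^*\mathbf s(e)=e^*$, - (CK1) $e^*f=\delta_{e,f}\mathbf r(e)$, - (SCK2) $v=\sum_{e\in\mathbf s^{-1}(v)}ee^*$ for every $v\in S$. It is an involutive $K$-algebra with the conjugate-linear involution determined by $v^*=v$, $(e)^*=e^*$, $(e^*)^*=e$. The Leavitt path algebra is $L_K(E)=CL_K(E,R(E))$. Given $S\subseteq R(E)$, let $E_S$ be the graph with vertices $E^0\cup\{v'\mid v\in R(E)\setminus S\}$ and edges $E^1\cup\{e'\mid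 e\in E^1,\ \mathbf r(e)\in R(E)\setminus S\}$ (the primed elements being new), with $\mathbf s,\mathbf r$ as in $E$ on $E^1$, and $\mathbf s(e')=\mathbf s(e)$, $\mathbf r(e')=\mathbf r(e)'$. Define $\phi$ on the vertices, edges and ghost edges of $E_S$, with values in $CL_K(E,S)$, by - $\phi(v)=v$ if $v\in E^0$, $v\notin R(E)\setminus S$; - $\phi(v)=\sum_{e\in\mathbf s^{-1}(v)}ee^*$ and $\phi(v')=v-\sum_{e\in\mathbf s^{-1}(v)}ee^*$ if $v\in R(E)\setminus S$ (sums over the edges of $E$ with source $v$); - $\phi(e)=e\,\phi(\mathbf r(e))$ for $e\in E^1$; - $\phi(e')=e\,\phi(\mathbf r(e)')$ for $e\in E^1$ with $\mathbf r(e)\in R(E)\setminus S$; - $\phi(f^*)=\phi(f)^*$ for every edge $f$ of $E_S$. Lemma. The map $\phi$ extends to a $*$-isomorphism of $K$-algebras $\phi: L_K(E_S)\cong CL_K(E,S)$. -/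

import Mathlib

/-- A directed graph with vertex set `V` and edge set `E`, given by its source and range maps.
There is no cardinality restriction; loops and multiple edges are allowed. -/
structure DirGraph (V E : Type*) where
  /-- source of an edge -/
  src : E → V
  /-- range of an edge -/
  rng : E → V

namespace DirGraph

variable {V E : Type*} (G : DirGraph V E)

/-- The set `s⁻¹(v)` of edges emitted by `v`. -/
def outEdges (v : V) : Set E := {e | G.src e = v}

/-- `v` is regular if `s⁻¹(v)` is nonempty and finite. -/
def IsRegular (v : V) : Prop := (G.outEdges v).Nonempty ∧ (G.outEdges v).Finite

/-- The set `R(E)` of regular vertices. -/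
def regularSet : Set V := {v | G.IsRegular v}

variable {G} in
/-- The finite set `s⁻¹(v)` of edges emitted by a regular vertex `v`. -/
noncomputable def IsRegular.outFinset {v : V} (h : G.IsRegular v) : Finset E := h.2.toFinset

/-- The graph `E_S`: to `E` one adds a vertex `v'` for every `v ∈ R(E) \ S`, and an edge `e'` for
every edge `e` with `r(e) ∈ R(E) \ S`; here `s(e') = s(e)` and `r(e') = r(e)'`.
The summand `Sum.inr` holds the primed copies. -/
def relativeGraph (S : Set V) :
    DirGraph (V ⊕ {v : V // v ∈ G.regularSet \ S}) (E ⊕ {e : E // G.rng e ∈ G.regularSet \ S}) where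
  src
    | Sum.inl e => Sum.inl (G.src e)
    | Sum.inr e => Sum.inl (G.src e.1)
  rng
    | Sum.inl e => Sum.inl (G.rng e)
    | Sum.inr e => Sum.inr ⟨G.rng e.1, e.2⟩

/-- The generators: the vertices `v`, the edges `e` and the ghost edges `e*`. -/
inductive Gen (V E : Type*)
  | vertex (v : V) : Gen V E
  | edge (e : E) : Gen V E
  | ghost (e : E) : Gen V E

/-- The involution on generators: `v ↦ v`, `e ↦ e*`, `e* ↦ e`. -/
def Gen.bar : Gen V E → Gen V E
  | vertex v => vertex v
  | edge e => ghost e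
  | ghost e => edge e

/-- The involution on nonempty words: `(x₁ ⋯ xₙ)* = xₙ* ⋯ x₁*`. -/
instance : Star (FreeSemigroup (Gen V E)) where
  star w := (FreeSemigroup.lift (fun x : Gen V E => MulOpposite.op (FreeSemigroup.of x.bar)) w).unop

theorem word_star_of (x : Gen V E) :
    star (FreeSemigroup.of x) = FreeSemigroup.of x.bar := rfl

theorem word_star_mul (a b : FreeSemigroup (Gen V E)) : star (a * b) = star b * star a := by
  exact congrArg MulOpposite.unop (map_mul (FreeSemigroup.lift
    (fun x : Gen V E => MulOpposite.op (FreeSemigroup.of x.bar))) a b)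

instance : StarMul (FreeSemigroup (Gen V E)) where
  star_mul := word_star_mul
  star_involutive w := by
    induction w with
    | ih1 x => cases x <;> rfl
    | ih2 x y hx hy => rw [word_star_mul, word_star_mul, hx, hy]

section Algebra

variable (K : Type*) [Field K]

/-- The free associative, not necessarily unital, `K`-algebra on the vertices, edges and ghost
edges: the semigroup algebra of the free semigroup of nonempty words. -/
abbrev FreeAlg (V E : Type*) := MonoidAlgebra K (FreeSemigroup (Gen V E))

/-- A generator as an element of the free algebra. -/
noncomputable def FreeAlg.gen (x : Gen V E) : FreeAlg K V E :=
  MonoidAlgebra.single (FreeSemigroup.of x) 1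

open FreeAlg Gen in
/-- The defining relations (V), (E1), (E2), (CK1), and (CK2) at the vertices of `S`
(`S` is meant to consist of regular vertices). -/
inductive Rel (S : Set V) : FreeAlg K V E → FreeAlg K V E → Prop
  | vertex_self (v : V) : Rel S (gen K (vertex v) * gen K (vertex v)) (gen K (vertex v))
  | vertex_ne {v w : V} (h : v ≠ w) : Rel S (gen K (vertex v) * gen K (vertex w)) 0
  | src_edge (e : E) : Rel S (gen K (vertex (G.src e)) * gen K (edge e)) (gen K (edge e))
  | edge_rng (e : E) : Rel S (gen K (edge e) * gen K (vertex (G.rng e))) (gen K (edge e))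
  | rng_ghost (e : E) : Rel S (gen K (vertex (G.rng e)) * gen K (ghost e)) (gen K (ghost e))
  | ghost_src (e : E) : Rel S (gen K (ghost e) * gen K (vertex (G.src e))) (gen K (ghost e))
  | ghost_edge_self (e : E) :
      Rel S (gen K (ghost e) * gen K (edge e)) (gen K (vertex (G.rng e)))
  | ghost_edge_ne {e f : E} (h : e ≠ f) : Rel S (gen K (ghost e) * gen K (edge f)) 0
  | ck2 {v : V} (hv : v ∈ S) (h : G.IsRegular v) :
      Rel S (gen K (vertex v)) (∑ e ∈ h.outFinset, gen K (edge e) * gen K (ghost e))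

/-- All scalar multiples of the defining relations. -/
def ScaledRel (S : Set V) (a b : FreeAlg K V E) : Prop :=
  ∃ (k : K) (x y : FreeAlg K V E), G.Rel K S x y ∧ a = k • x ∧ b = k • y

/-- The smallest algebra congruence on the free algebra that contains the defining relations. -/
noncomputable def con (S : Set V) : RingCon (FreeAlg K V E) := ringConGen (G.ScaledRel K S)

theorem con_smul (S : Set V) (k : K) {a b : FreeAlg K V E} (h : G.con K S a b) :
    G.con K S (k • a) (k • b) := by
  change RingConGen.Rel _ _ _
  change RingConGen.Rel _ _ _ at h
  induction h with
  | of x y h =>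
    obtain ⟨l, x, y, h, rfl, rfl⟩ := h
    exact .of _ _ ⟨k * l, x, y, h, smul_smul .., smul_smul ..⟩
  | refl x => exact .refl _
  | symm _ ih => exact .symm ih
  | trans _ _ ih₁ ih₂ => exact .trans ih₁ ih₂
  | add _ _ ih₁ ih₂ => rw [smul_add, smul_add]; exact .add ih₁ ih₂
  | mul _ h₂ ih₁ ih₂ =>
    rw [← smul_mul_assoc, ← smul_mul_assoc]
    exact .mul ih₁ h₂

/-- The Cohn-Leavitt algebra `CL_K(E, S)`: the free `K`-algebra on vertices, edges and ghost edges
modulo (V), (E1), (E2), (CK1), and (CK2) at the vertices of `S ⊆ R(E)`. -/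
def CohnLeavitt (S : Set V) : Type _ := (G.con K S).Quotient

/-- The Leavitt path algebra `L_K(E) = CL_K(E, R(E))`. -/
abbrev Leavitt : Type _ := G.CohnLeavitt K G.regularSet

namespace CohnLeavitt

variable (S : Set V)

noncomputable instance : NonUnitalRing (G.CohnLeavitt K S) :=
  inferInstanceAs (NonUnitalRing (G.con K S).Quotient)

variable {G K S} in
/-- The quotient map from the free algebra. -/
noncomputable def mk (a : FreeAlg K V E) : G.CohnLeavitt K S := RingCon.toQuotient a

theorem mk_surjective : Function.Surjective (mk : FreeAlg K V E → G.CohnLeavitt K S) :=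
  Quotient.mk''_surjective

theorem mk_eq {a b : FreeAlg K V E} :
    (mk a : G.CohnLeavitt K S) = mk b ↔ G.con K S a b := RingCon.eq _

theorem mk_add (a b : FreeAlg K V E) : (mk (a + b) : G.CohnLeavitt K S) = mk a + mk b := rfl

theorem mk_mul (a b : FreeAlg K V E) : (mk (a * b) : G.CohnLeavitt K S) = mk a * mk b := rfl

theorem mk_zero : (mk 0 : G.CohnLeavitt K S) = 0 := rfl

noncomputable instance : SMul K (G.CohnLeavitt K S) where
  smul k := Quotient.map (k • ·) fun _ _ h => G.con_smul K S k h

theorem mk_smul (k : K) (a : FreeAlg K V E) : (mk (k • a) : G.CohnLeavitt K S) = k • mk a := rfl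

noncomputable instance : Module K (G.CohnLeavitt K S) where
  one_smul x := by
    obtain ⟨a, rfl⟩ := mk_surjective G K S x
    rw [← mk_smul, one_smul]
  mul_smul k l x := by
    obtain ⟨a, rfl⟩ := mk_surjective G K S x
    simp only [← mk_smul, mul_smul]
  smul_zero k := by rw [← mk_zero, ← mk_smul, smul_zero]
  smul_add k x y := by
    obtain ⟨a, rfl⟩ := mk_surjective G K S x
    obtain ⟨b, rfl⟩ := mk_surjective G K S y
    simp only [← mk_smul, ← mk_add, smul_add]
  add_smul k l x := by
    obtain ⟨a, rfl⟩ := mk_surjective G K S x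
    simp only [← mk_smul, ← mk_add, add_smul]
  zero_smul x := by
    obtain ⟨a, rfl⟩ := mk_surjective G K S x
    rw [← mk_smul, zero_smul, mk_zero]

instance : IsScalarTower K (G.CohnLeavitt K S) (G.CohnLeavitt K S) where
  smul_assoc k x y := by
    obtain ⟨a, rfl⟩ := mk_surjective G K S x
    obtain ⟨b, rfl⟩ := mk_surjective G K S y
    simp only [smul_eq_mul, ← mk_smul, ← mk_mul, smul_mul_assoc]

instance : SMulCommClass K (G.CohnLeavitt K S) (G.CohnLeavitt K S) where
  smul_comm k x y := by
    obtain ⟨a, rfl⟩ := mk_surjective G K S x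
    obtain ⟨b, rfl⟩ := mk_surjective G K S y
    simp only [smul_eq_mul, ← mk_smul, ← mk_mul, mul_smul_comm]

/-- The element `v` of `CL_K(E, S)`. -/
noncomputable def vertex (v : V) : G.CohnLeavitt K S := mk (FreeAlg.gen K (.vertex v))

/-- The element `e` of `CL_K(E, S)`. -/
noncomputable def edge (e : E) : G.CohnLeavitt K S := mk (FreeAlg.gen K (.edge e))

/-- The element `e*` of `CL_K(E, S)`. -/
noncomputable def ghost (e : E) : G.CohnLeavitt K S := mk (FreeAlg.gen K (.ghost e))

end CohnLeavitt

section Star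

variable [StarRing K]

/-- The involution on the free algebra: conjugate-linear, and `w ↦ w*` on words. -/
noncomputable def freeStar : FreeAlg K V E →+ FreeAlg K V E where
  toFun x := MonoidAlgebra.mapDomain star (MonoidAlgebra.map (starAddEquiv : K ≃+ K) x)
  map_zero' := by
    rw [MonoidAlgebra.map_zero, MonoidAlgebra.mapDomain_zero]
  map_add' x y := by
    rw [MonoidAlgebra.map_add, MonoidAlgebra.mapDomain_add]

theorem freeStar_single (w : FreeSemigroup (Gen V E)) (k : K) :
    freeStar K (MonoidAlgebra.single w k) = MonoidAlgebra.single (star w) (star k) := by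
  simp [freeStar]

noncomputable instance : StarRing (FreeAlg K V E) where
  star := freeStar K
  star_involutive x := by
    change freeStar K (freeStar K x) = x
    induction x using MonoidAlgebra.induction_linear with
    | zero => simp
    | add x y hx hy => rw [map_add, map_add, hx, hy]
    | single w k => simp only [freeStar_single, star_star]
  star_mul x y := by
    change freeStar K (x * y) = freeStar K y * freeStar K x
    induction x using MonoidAlgebra.induction_linear with
    | zero => simp
    | add x x' hx hx' => rw [add_mul, map_add, map_add, mul_add, hx, hx']
    | single w k =>
      induction y using MonoidAlgebra.induction_linear with
      | zero => simp
      | add y y' hy hy' => rw [mul_add, map_add, map_add, add_mul, hy, hy']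
      | single w' k' =>
        simp only [MonoidAlgebra.single_mul_single, freeStar_single, star_mul]
  star_add x y := map_add (freeStar K) x y

theorem star_single (w : FreeSemigroup (Gen V E)) (k : K) :
    star (MonoidAlgebra.single w k : FreeAlg K V E) = MonoidAlgebra.single (star w) (star k) :=
  freeStar_single K w k

theorem star_gen (x : Gen V E) : star (FreeAlg.gen K x) = FreeAlg.gen K x.bar := by
  rw [FreeAlg.gen, star_single, star_one, word_star_of]; rfl

instance : StarModule K (FreeAlg K V E) where
  star_smul k x := by
    induction x using MonoidAlgebra.induction_linear with
    | zero => simp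
    | add x y hx hy => simp only [smul_add, star_add, hx, hy]
    | single w l =>
      simp only [MonoidAlgebra.smul_single, star_single, smul_eq_mul, star_mul']

theorem Rel.star {S : Set V} {a b : FreeAlg K V E} (h : G.Rel K S a b) :
    G.Rel K S (star a) (star b) := by
  cases h with
  | vertex_self v => simpa only [star_mul, star_gen] using .vertex_self v
  | vertex_ne h => simpa only [star_mul, star_gen, star_zero] using .vertex_ne h.symm
  | src_edge e => simpa only [star_mul, star_gen] using .ghost_src e
  | edge_rng e => simpa only [star_mul, star_gen] using .rng_ghost e
  | rng_ghost e => simpa only [star_mul, star_gen] using .edge_rng e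
  | ghost_src e => simpa only [star_mul, star_gen] using .src_edge e
  | ghost_edge_self e => simpa only [star_mul, star_gen] using .ghost_edge_self e
  | ghost_edge_ne h => simpa only [star_mul, star_gen, star_zero] using .ghost_edge_ne h.symm
  | ck2 hv h => simpa only [star_sum, star_mul, star_gen] using .ck2 hv h

theorem con_star (S : Set V) {a b : FreeAlg K V E} (h : G.con K S a b) :
    G.con K S (star a) (star b) := by
  refine ringConGen_star ?_ h
  rintro _ _ ⟨k, x, y, h, rfl, rfl⟩
  exact ⟨Star.star k, _, _, h.star, star_smul .., star_smul ..⟩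

namespace CohnLeavitt

variable (S : Set V)

noncomputable instance : Star (G.CohnLeavitt K S) where
  star := Quotient.map star fun _ _ h => G.con_star K S h

theorem mk_star (a : FreeAlg K V E) : (mk (star a) : G.CohnLeavitt K S) = star (mk a) := rfl

/-- The involution on `CL_K(E, S)` induced by the involution of `K`, so that
`(∑ aᵢ pᵢ qᵢ*)* = ∑ aᵢ* qᵢ pᵢ*`. -/
noncomputable instance : StarRing (G.CohnLeavitt K S) where
  star_involutive x := by
    obtain ⟨a, rfl⟩ := mk_surjective G K S x
    rw [← mk_star, ← mk_star, star_star]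
  star_mul x y := by
    obtain ⟨a, rfl⟩ := mk_surjective G K S x
    obtain ⟨b, rfl⟩ := mk_surjective G K S y
    simp only [← mk_star, ← mk_mul, star_mul]
  star_add x y := by
    obtain ⟨a, rfl⟩ := mk_surjective G K S x
    obtain ⟨b, rfl⟩ := mk_surjective G K S y
    simp only [← mk_star, ← mk_add, star_add]

instance : StarModule K (G.CohnLeavitt K S) where
  star_smul k x := by
    obtain ⟨a, rfl⟩ := mk_surjective G K S x
    simp only [← mk_star, ← mk_smul, star_smul]

theorem star_vertex (v : V) : star (vertex G K S v) = vertex G K S v := by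
  rw [vertex, ← mk_star, star_gen]; rfl

theorem star_edge (e : E) : star (edge G K S e) = ghost G K S e := by
  rw [edge, ← mk_star, star_gen]; rfl

theorem star_ghost (e : E) : star (ghost G K S e) = edge G K S e := by
  rw [ghost, ← mk_star, star_gen]; rfl

end CohnLeavitt

end Star

/-! The map `φ` from the generators of `L_K(E_S)` to `CL_K(E, S)`. -/

section Phi

variable (S : Set V)

open CohnLeavitt

open scoped Classical in
/-- `φ` on vertices: `φ(v) = v` if `v ∉ R(E) \ S`; for `v ∈ R(E) \ S`,
`φ(v) = ∑_{e ∈ s⁻¹(v)} e e*` and `φ(v') = v - ∑_{e ∈ s⁻¹(v)} e e*`. -/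
noncomputable def phiVertex : V ⊕ {v : V // v ∈ G.regularSet \ S} → G.CohnLeavitt K S
  | Sum.inl v =>
      if h : v ∈ G.regularSet \ S then
        ∑ e ∈ IsRegular.outFinset (G := G) h.1, edge G K S e * ghost G K S e
      else vertex G K S v
  | Sum.inr v =>
      vertex G K S v.1 - ∑ e ∈ IsRegular.outFinset (G := G) v.2.1, edge G K S e * ghost G K S e

/-- `φ` on edges: `φ(e) = e φ(r(e))`, and `φ(e') = e φ(r(e)')` if `r(e) ∈ R(E) \ S`. -/
noncomputable def phiEdge : E ⊕ {e : E // G.rng e ∈ G.regularSet \ S} → G.CohnLeavitt K S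
  | Sum.inl e => edge G K S e * G.phiVertex K S (Sum.inl (G.rng e))
  | Sum.inr e => edge G K S e.1 * G.phiVertex K S (Sum.inr ⟨G.rng e.1, e.2⟩)

/-- `φ` on ghost edges: `φ(f*) = φ(f)*`. -/
noncomputable def phiGhost [StarRing K] (f : E ⊕ {e : E // G.rng e ∈ G.regularSet \ S}) :
    G.CohnLeavitt K S :=
  star (G.phiEdge K S f)

end Phi

end Algebra

end DirGraph

/-! For a regular vertex `v` let `q_v` be the sum of `e e*` over the edges emitted by `v`
(`rangeSum`). In `CL_K(E, S)` it is a self-adjoint idempotent below `v`, and it equals `v` when `v ∈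
S`. For `v ∈ R(E) \ S` the vertex therefore splits into the orthogonal idempotents `q_v` and `v -
q_v`, and every edge `e` ending at `v` splits into `e q_v` and `e (v - q_v)`. The graph `E_S`
records this splitting: `v'` is a sink carrying the defect of (CK2) at `v`, and `e`, `e'` are the
two parts of an edge.

Algebraically, the pieces satisfy the relations of `L_K(E_S)` (`isStarFamily_phi`): the two parts of
`e` contribute `e e*` together, so (CK2) of `E_S` at `v` reads `φ(v) = q_v`. Conversely `v ↦ v +
v'`, `e ↦ e + e'` (without the primed term where there is none) satisfies the relations of `CL_K(E,
S)` (`isStarFamily_psi`). The universal properties give `*`-homomorphisms both ways. They are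
mutually inverse on vertices and edges, hence everywhere; the decisive computation is that the
second one sends `q_v` to `v` (`lift_psi_rangeSum`). No basis or uniqueness theorem is needed. -/

namespace DirGraph

open CohnLeavitt

variable {V E : Type*} (G : DirGraph V E)

namespace IsRegular

variable {G}

theorem mem_outFinset {v : V} (h : G.IsRegular v) {e : E} : e ∈ h.outFinset ↔ G.src e = v := by
  simp [outFinset, outEdges]

end IsRegular

/-- Vertices `p v` and edges `x e` of a `*`-algebra satisfying, together with the ghost edges
`star (x e)`, the defining relations of `CL_K(E, S)`. -/
structure IsStarFamily {A : Type*} [NonUnitalRing A] [StarRing A] (S : Set V)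
    (p : V → A) (x : E → A) : Prop where
  star_vertex (v : V) : star (p v) = p v
  vertex_self (v : V) : p v * p v = p v
  vertex_ne {v w : V} (h : v ≠ w) : p v * p w = 0
  src_edge (e : E) : p (G.src e) * x e = x e
  edge_rng (e : E) : x e * p (G.rng e) = x e
  ghost_edge_self (e : E) : star (x e) * x e = p (G.rng e)
  ghost_edge_ne {e f : E} (h : e ≠ f) : star (x e) * x f = 0
  ck2 {v : V} (hv : v ∈ S) (h : G.IsRegular v) : p v = ∑ e ∈ h.outFinset, x e * star (x e)

/-! ### The universal property of Cohn-Leavitt algebras -/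

namespace CohnLeavitt

variable {G} {K : Type*} [Field K] {S : Set V}

theorem mk_sum {ι : Type*} (s : Finset ι) (f : ι → FreeAlg K V E) :
    (mk (∑ i ∈ s, f i) : G.CohnLeavitt K S) = ∑ i ∈ s, mk (f i) :=
  map_sum (AddMonoidHom.mk' mk (mk_add G K S)) f s

theorem mk_eq_of_rel {a b : FreeAlg K V E} (h : G.Rel K S a b) :
    (mk a : G.CohnLeavitt K S) = mk b :=
  (mk_eq ..).2 (RingConGen.Rel.of _ _ ⟨1, a, b, h, (one_smul ..).symm, (one_smul ..).symm⟩)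

/-- A property that is preserved by sums, products and scalar multiples holds on `CL_K(E, S)` as
soon as it holds for `0` and the generators. -/
theorem induction {P : G.CohnLeavitt K S → Prop} (vertex : ∀ v, P (vertex G K S v))
    (edge : ∀ e, P (edge G K S e)) (ghost : ∀ e, P (ghost G K S e)) (zero : P 0)
    (add : ∀ a b, P a → P b → P (a + b)) (mul : ∀ a b, P a → P b → P (a * b))
    (smul : ∀ (k : K) a, P a → P (k • a)) (a : G.CohnLeavitt K S) : P a := by
  have gen (x : Gen V E) : P (mk (FreeAlg.gen K x)) := by
    cases x with
    | vertex v => exact vertex v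
    | edge e => exact edge e
    | ghost e => exact ghost e
  have word (w : FreeSemigroup (Gen V E)) : P (mk (MonoidAlgebra.single w 1)) := by
    induction w with
    | ih1 x => exact gen x
    | ih2 x y hx hy =>
      have := mul _ _ hx hy
      rwa [← mk_mul, MonoidAlgebra.single_mul_single, one_mul] at this
  have single (w : FreeSemigroup (Gen V E)) (k : K) : P (mk (MonoidAlgebra.single w k)) := by
    have := smul k _ (word w)
    rwa [← mk_smul, MonoidAlgebra.smul_single, smul_eq_mul, mul_one] at this
  obtain ⟨a, rfl⟩ := mk_surjective G K S a
  induction a using MonoidAlgebra.induction_linear with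
  | zero => exact zero
  | add x y hx hy => exact add _ _ hx hy
  | single w k => exact single w k

section Relations

variable (S)

theorem vertex_mul_self (v : V) : vertex G K S v * vertex G K S v = vertex G K S v :=
  mk_eq_of_rel (.vertex_self v)

theorem vertex_mul_of_ne {v w : V} (h : v ≠ w) : vertex G K S v * vertex G K S w = 0 :=
  mk_eq_of_rel (.vertex_ne h)

theorem vertex_src_mul_edge (e : E) :
    vertex G K S (G.src e) * edge G K S e = edge G K S e :=
  mk_eq_of_rel (.src_edge e)

theorem edge_mul_vertex_rng (e : E) :
    edge G K S e * vertex G K S (G.rng e) = edge G K S e :=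
  mk_eq_of_rel (.edge_rng e)

theorem ghost_mul_vertex_src (e : E) :
    ghost G K S e * vertex G K S (G.src e) = ghost G K S e :=
  mk_eq_of_rel (.ghost_src e)

theorem ghost_mul_edge_self (e : E) :
    ghost G K S e * edge G K S e = vertex G K S (G.rng e) :=
  mk_eq_of_rel (.ghost_edge_self e)

theorem ghost_mul_edge_of_ne {e f : E} (h : e ≠ f) : ghost G K S e * edge G K S f = 0 :=
  mk_eq_of_rel (.ghost_edge_ne h)

theorem vertex_eq_sum {v : V} (hv : v ∈ S) (h : G.IsRegular v) :
    vertex G K S v = ∑ e ∈ h.outFinset, edge G K S e * ghost G K S e :=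
  (mk_eq_of_rel (.ck2 hv h)).trans (mk_sum ..)

end Relations

section Lift

variable {A : Type*} [NonUnitalRing A] [StarRing A] [Module K A] [IsScalarTower K A A]
  [SMulCommClass K A A] (p : V → A) (x : E → A)

/-- The homomorphism from the free algebra given by vertices `p` and edges `x`. -/
noncomputable def freeLift : FreeAlg K V E →ₙₐ[K] A :=
  MonoidAlgebra.liftMagma K (FreeSemigroup.lift fun
    | Gen.vertex v => p v
    | Gen.edge e => x e
    | Gen.ghost e => star (x e))

@[simp] theorem freeLift_vertex (v : V) : freeLift p x (FreeAlg.gen K (.vertex v)) = p v := by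
  simp [freeLift, FreeAlg.gen]

@[simp] theorem freeLift_edge (e : E) : freeLift p x (FreeAlg.gen K (.edge e)) = x e := by
  simp [freeLift, FreeAlg.gen]

@[simp] theorem freeLift_ghost (e : E) :
    freeLift p x (FreeAlg.gen K (.ghost e)) = star (x e) := by
  simp [freeLift, FreeAlg.gen]

variable {p x}

/-- The relations (E2) are not required of a star family: they are the adjoints of (E1), since the
vertices are self-adjoint. -/
theorem freeLift_eq_of_rel (h : G.IsStarFamily S p x) {a b : FreeAlg K V E}
    (hab : G.Rel K S a b) : freeLift p x a = freeLift p x b := by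
  cases hab with
  | vertex_self v => simp [h.vertex_self]
  | vertex_ne hne => simp [h.vertex_ne hne]
  | src_edge e => simp [h.src_edge]
  | edge_rng e => simp [h.edge_rng]
  | rng_ghost e => simpa [h.star_vertex] using congrArg star (h.edge_rng e)
  | ghost_src e => simpa [h.star_vertex] using congrArg star (h.src_edge e)
  | ghost_edge_self e => simp [h.ghost_edge_self]
  | ghost_edge_ne hne => simp [h.ghost_edge_ne hne]
  | ck2 hv hr => simp [map_sum, ← h.ck2 hv hr]

theorem freeLift_eq_of_con (h : G.IsStarFamily S p x) {a b : FreeAlg K V E}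
    (hab : G.con K S a b) : freeLift p x a = freeLift p x b := by
  change RingConGen.Rel _ _ _ at hab
  induction hab with
  | of a b hab =>
    obtain ⟨k, a, b, hab, rfl, rfl⟩ := hab
    rw [map_smul, map_smul, freeLift_eq_of_rel h hab]
  | refl => rfl
  | symm _ ih => exact ih.symm
  | trans _ _ ih₁ ih₂ => exact ih₁.trans ih₂
  | add _ _ ih₁ ih₂ => rw [map_add, map_add, ih₁, ih₂]
  | mul _ _ ih₁ ih₂ => rw [map_mul, map_mul, ih₁, ih₂]

/-- The homomorphism of algebras given by the universal property of `CL_K(E, S)`. -/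
noncomputable def liftAlgHom (h : G.IsStarFamily S p x) : G.CohnLeavitt K S →ₙₐ[K] A where
  toFun := Quotient.lift (freeLift p x) fun _ _ hab => freeLift_eq_of_con h hab
  map_smul' k a := by
    obtain ⟨a, rfl⟩ := mk_surjective G K S a
    exact map_smul (freeLift p x) k a
  map_zero' := map_zero (freeLift (K := K) p x)
  map_add' a b := by
    obtain ⟨a, rfl⟩ := mk_surjective G K S a
    obtain ⟨b, rfl⟩ := mk_surjective G K S b
    exact map_add (freeLift p x) a b
  map_mul' a b := by
    obtain ⟨a, rfl⟩ := mk_surjective G K S a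
    obtain ⟨b, rfl⟩ := mk_surjective G K S b
    exact map_mul (freeLift p x) a b

theorem liftAlgHom_vertex (h : G.IsStarFamily S p x) (v : V) :
    liftAlgHom h (vertex G K S v) = p v := freeLift_vertex p x v

theorem liftAlgHom_edge (h : G.IsStarFamily S p x) (e : E) :
    liftAlgHom h (edge G K S e) = x e := freeLift_edge p x e

theorem liftAlgHom_ghost (h : G.IsStarFamily S p x) (e : E) :
    liftAlgHom h (ghost G K S e) = star (x e) := freeLift_ghost p x e

variable [StarRing K] [StarModule K A]

/-- The `*`-homomorphism given by the universal property of `CL_K(E, S)`. -/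
noncomputable def lift (h : G.IsStarFamily S p x) : G.CohnLeavitt K S →⋆ₙₐ[K] A where
  __ := liftAlgHom h
  map_star' a := by
    change liftAlgHom h (star a) = star (liftAlgHom h a)
    induction a using induction with
    | vertex v => rw [star_vertex, liftAlgHom_vertex, h.star_vertex]
    | edge e => rw [star_edge, liftAlgHom_ghost, liftAlgHom_edge]
    | ghost e => rw [star_ghost, liftAlgHom_ghost, liftAlgHom_edge, star_star]
    | zero => simp only [star_zero, map_zero]
    | add a b ha hb => rw [star_add, map_add, map_add, star_add, ha, hb]
    | mul a b ha hb => rw [star_mul, map_mul, map_mul, star_mul, ha, hb]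
    | smul k a ha => rw [star_smul, map_smul, map_smul, star_smul, ha]

@[simp] theorem lift_vertex (h : G.IsStarFamily S p x) (v : V) :
    lift h (vertex G K S v) = p v := liftAlgHom_vertex h v

@[simp] theorem lift_edge (h : G.IsStarFamily S p x) (e : E) :
    lift h (edge G K S e) = x e := liftAlgHom_edge h e

@[simp] theorem lift_ghost (h : G.IsStarFamily S p x) (e : E) :
    lift h (ghost G K S e) = star (x e) := liftAlgHom_ghost h e

end Lift

/-- Ghost edges need no hypothesis, being the stars of edges. -/
theorem starHom_ext {A : Type*} [NonUnitalRing A] [StarRing A] [Module K A] [StarRing K]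
    {f g : G.CohnLeavitt K S →⋆ₙₐ[K] A}
    (hv : ∀ v, f (vertex G K S v) = g (vertex G K S v))
    (he : ∀ e, f (edge G K S e) = g (edge G K S e)) : f = g := by
  ext a
  induction a using induction with
  | vertex v => exact hv v
  | edge e => exact he e
  | ghost e => rw [← star_edge, map_star, map_star, he]
  | zero => rw [map_zero, map_zero]
  | add a b ha hb => rw [map_add, map_add, ha, hb]
  | mul a b ha hb => rw [map_mul, map_mul, ha, hb]
  | smul k a ha => rw [map_smul, map_smul, ha]

end CohnLeavitt

/-! ### Regular vertices and emitted edges of `E_S` -/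

section RelativeGraph

variable {G} {S : Set V}

theorem isRegular_of_mem_diff {v : V} (h : v ∈ G.regularSet \ S) : G.IsRegular v := h.1

/-- The map `Sum.elim id Subtype.val` erases primes, on edges as on vertices; through it,
computations in `E_S` are reduced to `E`. -/
theorem src_relativeGraph (f : E ⊕ {e : E // G.rng e ∈ G.regularSet \ S}) :
    (G.relativeGraph S).src f = Sum.inl (G.src (Sum.elim id Subtype.val f)) := by
  cases f <;> rfl

theorem rng_relativeGraph (f : E ⊕ {e : E // G.rng e ∈ G.regularSet \ S}) :
    Sum.elim id Subtype.val ((G.relativeGraph S).rng f) =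
      G.rng (Sum.elim id Subtype.val f) := by
  cases f <;> rfl

/-- All sources in `E_S` are unprimed, so `v'` is a sink and (CK2) says nothing there. -/
theorem not_isRegular_relativeGraph_inr (v : {v : V // v ∈ G.regularSet \ S}) :
    ¬ (G.relativeGraph S).IsRegular (Sum.inr v) := by
  rintro ⟨⟨f, hf⟩, -⟩
  rw [outEdges, Set.mem_ofPred_eq, src_relativeGraph] at hf
  exact Sum.inl_ne_inr hf

/-- The edges emitted by `v` in `E_S` are the preimage of those in `E` under the erasure of primes,
which is surjective with fibres of at most two elements. -/
theorem isRegular_relativeGraph_inl {v : V} :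
    (G.relativeGraph S).IsRegular (Sum.inl v) ↔ G.IsRegular v := by
  have h : (G.relativeGraph S).outEdges (Sum.inl v) =
      Sum.elim id Subtype.val ⁻¹' G.outEdges v := by
    ext f
    rw [outEdges, Set.mem_ofPred_eq, src_relativeGraph, Sum.inl_injective.eq_iff]
    rfl
  have himage : Sum.inl ⁻¹' ((G.relativeGraph S).outEdges (Sum.inl v)) = G.outEdges v := by
    rw [h]; rfl
  constructor
  · rintro ⟨⟨f, hf⟩, hfin⟩
    rw [h] at hf
    exact ⟨⟨_, hf⟩, himage ▸ hfin.preimage Sum.inl_injective.injOn⟩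
  · rintro ⟨⟨e, he⟩, hfin⟩
    refine ⟨⟨Sum.inl e, by rw [h]; exact he⟩, ?_⟩
    rw [h]
    refine ((hfin.image Sum.inl).union
      ((hfin.preimage Subtype.val_injective.injOn).image Sum.inr)).subset ?_
    rintro (e | e) he
    · exact Or.inl ⟨e, he, rfl⟩
    · exact Or.inr ⟨e, he, rfl⟩

open scoped Classical in
-- Turns a (CK2) sum of `E_S` into a sum over edges of `E`, grouping `e` with `e'` when the latter
-- exists.
theorem sum_outFinset_relativeGraph {M : Type*} [AddCommMonoid M] {v : V} (h : G.IsRegular v)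
    (h' : (G.relativeGraph S).IsRegular (Sum.inl v))
    (f : E ⊕ {e : E // G.rng e ∈ G.regularSet \ S} → M) :
    ∑ e ∈ h'.outFinset, f e = ∑ e ∈ h.outFinset,
      (f (Sum.inl e) + if he : G.rng e ∈ G.regularSet \ S then f (Sum.inr ⟨e, he⟩) else 0) := by
  have : h'.outFinset = h.outFinset.disjSum
      (h.outFinset.subtype fun e => G.rng e ∈ G.regularSet \ S) := by
    ext (e | e) <;> simp [IsRegular.mem_outFinset, src_relativeGraph]
  rw [this, Finset.sum_disjSum, Finset.sum_add_distrib]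
  congr 1
  rw [Finset.sum_dite, Finset.sum_const_zero, add_zero]
  refine Finset.sum_bij' (fun e he => ⟨e.1, by simpa using ⟨Finset.mem_subtype.1 he, e.2⟩⟩)
    (fun e _ => ⟨e.1, by simpa using (Finset.mem_filter.1 e.2).2⟩) ?_ ?_ ?_ ?_ ?_ <;> simp
  exact fun a ha _ _ => ha

end RelativeGraph

/-! ### The family `φ` in `CL_K(E, S)` -/

section Projections

variable {K : Type*} [Field K] {S : Set V}

variable (K S) in
/-- The element `∑_{e ∈ s⁻¹(v)} e e*` of `CL_K(E, S)`. -/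
noncomputable def rangeSum {v : V} (h : G.IsRegular v) : G.CohnLeavitt K S :=
  ∑ e ∈ h.outFinset, edge G K S e * ghost G K S e

variable {G}

theorem vertex_mul_rangeSum {v : V} (h : G.IsRegular v) :
    vertex G K S v * G.rangeSum K S h = G.rangeSum K S h := by
  rw [rangeSum, Finset.mul_sum]
  refine Finset.sum_congr rfl fun e he => ?_
  rw [← mul_assoc, ← h.mem_outFinset.1 he, vertex_src_mul_edge]

theorem rangeSum_mul_vertex {v : V} (h : G.IsRegular v) :
    G.rangeSum K S h * vertex G K S v = G.rangeSum K S h := by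
  rw [rangeSum, Finset.sum_mul]
  refine Finset.sum_congr rfl fun e he => ?_
  rw [mul_assoc, ← h.mem_outFinset.1 he, ghost_mul_vertex_src]

/-- By (CK1) only the summand of `e` survives, and `e e* e = e r(e) = e`. -/
theorem rangeSum_mul_edge {e : E} (h : G.IsRegular (G.src e)) :
    G.rangeSum K S h * edge G K S e = edge G K S e := by
  rw [rangeSum, Finset.sum_mul, Finset.sum_eq_single_of_mem e (h.mem_outFinset.2 rfl)]
  · rw [mul_assoc, ghost_mul_edge_self, edge_mul_vertex_rng]
  · intro f _ hf
    rw [mul_assoc, ghost_mul_edge_of_ne S hf, mul_zero]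

theorem rangeSum_mul_self {v : V} (h : G.IsRegular v) :
    G.rangeSum K S h * G.rangeSum K S h = G.rangeSum K S h := by
  nth_rw 2 3 [rangeSum]
  rw [Finset.mul_sum]
  refine Finset.sum_congr rfl fun e he => ?_
  obtain rfl := h.mem_outFinset.1 he
  rw [← mul_assoc, rangeSum_mul_edge]

theorem star_rangeSum [StarRing K] {v : V} (h : G.IsRegular v) :
    star (G.rangeSum K S h) = G.rangeSum K S h := by
  simp only [rangeSum, star_sum, star_mul, star_edge, star_ghost]

theorem phiVertex_inl_of_mem {v : V} (h : v ∈ G.regularSet \ S) :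
    G.phiVertex K S (Sum.inl v) =
      G.rangeSum K S (isRegular_of_mem_diff h) := dif_pos h

theorem phiVertex_inl_of_notMem {v : V} (h : v ∉ G.regularSet \ S) :
    G.phiVertex K S (Sum.inl v) = vertex G K S v := dif_neg h

theorem phiVertex_inr (v : {v : V // v ∈ G.regularSet \ S}) :
    G.phiVertex K S (Sum.inr v) = vertex G K S v.1 - G.rangeSum K S (isRegular_of_mem_diff v.2) := rfl

open scoped Classical in
-- The splitting of a vertex. It yields both the (CK2) sums for `φ` and the fact that `φ` undoes `v
-- ↦ v + v'`.
theorem phiVertex_add (v : V) : (G.phiVertex K S (Sum.inl v) +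
    if h : v ∈ G.regularSet \ S then G.phiVertex K S (Sum.inr ⟨v, h⟩) else 0) =
      vertex G K S v := by
  split_ifs with h
  · rw [phiVertex_inl_of_mem h, phiVertex_inr, add_sub_cancel]
  · rw [phiVertex_inl_of_notMem h, add_zero]

/-- For `v ∈ S` this is (SCK2), otherwise the definition of `φ`; later arguments thus need not
distinguish the two kinds of regular vertex. -/
theorem phiVertex_inl_of_isRegular {v : V} (h : G.IsRegular v) :
    G.phiVertex K S (Sum.inl v) = G.rangeSum K S h := by
  by_cases hv : v ∈ S
  · rw [phiVertex_inl_of_notMem (fun h' => h'.2 hv), vertex_eq_sum S hv h, rangeSum]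
  · exact phiVertex_inl_of_mem ⟨h, hv⟩

theorem star_phiVertex [StarRing K] (a : V ⊕ {v : V // v ∈ G.regularSet \ S}) :
    star (G.phiVertex K S a) = G.phiVertex K S a := by
  rcases a with v | v
  · by_cases h : v ∈ G.regularSet \ S
    · rw [phiVertex_inl_of_mem h, star_rangeSum]
    · rw [phiVertex_inl_of_notMem h, star_vertex]
  · rw [phiVertex_inr, star_sub, star_vertex, star_rangeSum]

theorem vertex_mul_phiVertex (a : V ⊕ {v : V // v ∈ G.regularSet \ S}) :
    vertex G K S (Sum.elim id Subtype.val a) * G.phiVertex K S a = G.phiVertex K S a := by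
  rcases a with v | v
  · by_cases h : v ∈ G.regularSet \ S
    · rw [phiVertex_inl_of_mem h]
      exact vertex_mul_rangeSum h.1
    · rw [phiVertex_inl_of_notMem h]
      exact vertex_mul_self S v
  · rw [phiVertex_inr, mul_sub]
    exact congrArg₂ _ (vertex_mul_self S v.1) (vertex_mul_rangeSum v.2.1)

theorem phiVertex_mul_vertex (a : V ⊕ {v : V // v ∈ G.regularSet \ S}) :
    G.phiVertex K S a * vertex G K S (Sum.elim id Subtype.val a) = G.phiVertex K S a := by
  rcases a with v | v
  · by_cases h : v ∈ G.regularSet \ S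
    · rw [phiVertex_inl_of_mem h]
      exact rangeSum_mul_vertex h.1
    · rw [phiVertex_inl_of_notMem h]
      exact vertex_mul_self S v
  · rw [phiVertex_inr, sub_mul]
    exact congrArg₂ _ (vertex_mul_self S v.1) (rangeSum_mul_vertex v.2.1)

theorem phiVertex_mul_self (a : V ⊕ {v : V // v ∈ G.regularSet \ S}) :
    G.phiVertex K S a * G.phiVertex K S a = G.phiVertex K S a := by
  rcases a with v | v
  · by_cases h : v ∈ G.regularSet \ S
    · rw [phiVertex_inl_of_mem h, rangeSum_mul_self]
    · rw [phiVertex_inl_of_notMem h, vertex_mul_self]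
  · rw [phiVertex_inr, mul_sub, sub_mul, sub_mul, vertex_mul_self, vertex_mul_rangeSum,
      rangeSum_mul_vertex, rangeSum_mul_self, sub_self, sub_zero]

theorem phiVertex_mul_of_ne {a b : V ⊕ {v : V // v ∈ G.regularSet \ S}} (h : a ≠ b) :
    G.phiVertex K S a * G.phiVertex K S b = 0 := by
  -- Over one vertex of `E` the only distinct pair is `v`, `v'`, and `q_v` is orthogonal to `v -
  -- q_v`; over distinct vertices, (V) in `CL_K(E, S)` suffices.
  by_cases hab : Sum.elim id Subtype.val a = Sum.elim id Subtype.val b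
  · rcases a with v | ⟨v, hv⟩ <;> rcases b with w | ⟨w, hw⟩ <;> obtain rfl : v = w := hab
    · exact absurd rfl h
    · rw [phiVertex_inl_of_mem hw, phiVertex_inr, mul_sub, rangeSum_mul_vertex,
        rangeSum_mul_self, sub_self]
    · rw [phiVertex_inl_of_mem hv, phiVertex_inr, sub_mul, vertex_mul_rangeSum,
        rangeSum_mul_self, sub_self]
    · exact absurd rfl h
  · rw [← phiVertex_mul_vertex a, ← vertex_mul_phiVertex b, mul_assoc,
      ← mul_assoc (vertex ..), vertex_mul_of_ne S hab, zero_mul, mul_zero]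

theorem phiEdge_eq (f : E ⊕ {e : E // G.rng e ∈ G.regularSet \ S}) :
    G.phiEdge K S f = edge G K S (Sum.elim id Subtype.val f) *
      G.phiVertex K S ((G.relativeGraph S).rng f) := by
  cases f <;> rfl

variable [StarRing K]

theorem star_phiEdge (f : E ⊕ {e : E // G.rng e ∈ G.regularSet \ S}) :
    star (G.phiEdge K S f) = G.phiVertex K S ((G.relativeGraph S).rng f) *
      ghost G K S (Sum.elim id Subtype.val f) := by
  rw [phiEdge_eq, star_mul, star_phiVertex, star_edge]

theorem phiEdge_mul_star (f : E ⊕ {e : E // G.rng e ∈ G.regularSet \ S}) :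
    G.phiEdge K S f * star (G.phiEdge K S f) = edge G K S (Sum.elim id Subtype.val f) *
      G.phiVertex K S ((G.relativeGraph S).rng f) *
        ghost G K S (Sum.elim id Subtype.val f) := by
  rw [star_phiEdge, phiEdge_eq, mul_assoc, ← mul_assoc (G.phiVertex ..), phiVertex_mul_self,
    mul_assoc]

/-- The middle factor `e* e = r(e)` is absorbed. This reduces (CK1) for the pair `e`, `e'` to
orthogonality of their ranges. -/
theorem star_phiEdge_mul_of_eq {f g : E ⊕ {e : E // G.rng e ∈ G.regularSet \ S}}
    (h : Sum.elim id Subtype.val f = Sum.elim id Subtype.val g) :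
    star (G.phiEdge K S f) * G.phiEdge K S g =
      G.phiVertex K S ((G.relativeGraph S).rng f) *
        G.phiVertex K S ((G.relativeGraph S).rng g) := by
  rw [star_phiEdge, phiEdge_eq, ← h, mul_assoc, ← mul_assoc (ghost ..), ghost_mul_edge_self,
    ← mul_assoc, ← rng_relativeGraph, phiVertex_mul_vertex]

open scoped Classical in
theorem phiEdge_mul_star_add (e : E) :
    (G.phiEdge K S (Sum.inl e) * star (G.phiEdge K S (Sum.inl e)) +
      if h : G.rng e ∈ G.regularSet \ S then
        G.phiEdge K S (Sum.inr ⟨e, h⟩) * star (G.phiEdge K S (Sum.inr ⟨e, h⟩)) else 0) =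
      edge G K S e * ghost G K S e := by
  -- Conjugate the splitting of `r(e)` by `e`.
  have key := congrArg (fun a => edge G K S e * a * ghost G K S e)
    (phiVertex_add (G := G) (K := K) (S := S) (G.rng e))
  simp only [edge_mul_vertex_rng, mul_add, add_mul] at key
  rw [← key, phiEdge_mul_star]
  congr 1
  split_ifs
  · rw [phiEdge_mul_star]; rfl
  · rw [mul_zero, zero_mul]

variable (G K S) in
theorem isStarFamily_phi : (G.relativeGraph S).IsStarFamily (G.relativeGraph S).regularSet
    (G.phiVertex K S) (G.phiEdge K S) where
  star_vertex := star_phiVertex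
  vertex_self := phiVertex_mul_self
  vertex_ne := phiVertex_mul_of_ne
  src_edge f := by
    rw [phiEdge_eq, src_relativeGraph]
    set e : E := Sum.elim id Subtype.val f
    rw [← mul_assoc]
    congr 1
    -- If `s(e)` is regular, its image is `q_{s(e)}`, which fixes `e` on the left; otherwise its
    -- image is `s(e)` itself.
    by_cases h : G.IsRegular (G.src e)
    · rw [phiVertex_inl_of_isRegular h, rangeSum_mul_edge]
    · rw [phiVertex_inl_of_notMem (fun h' => h h'.1), vertex_src_mul_edge]
  edge_rng f := by rw [phiEdge_eq, mul_assoc, phiVertex_mul_self]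
  ghost_edge_self f := by rw [star_phiEdge_mul_of_eq rfl, phiVertex_mul_self]
  ghost_edge_ne {f g} hne := by
    by_cases h : Sum.elim id Subtype.val f = Sum.elim id Subtype.val g
    · rw [star_phiEdge_mul_of_eq h, phiVertex_mul_of_ne]
      rcases f with e | ⟨e, he⟩ <;> rcases g with e' | ⟨e', he'⟩ <;> obtain rfl : e = e' := h
      · exact absurd rfl hne
      · exact Sum.inl_ne_inr
      · exact Sum.inr_ne_inl
      · exact absurd rfl hne
    · rw [star_phiEdge, phiEdge_eq, mul_assoc, ← mul_assoc (ghost ..),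
        ghost_mul_edge_of_ne S h, zero_mul, mul_zero]
  ck2 {a} _ h := by
    rcases a with v | v
    · have hv := isRegular_relativeGraph_inl.1 h
      rw [phiVertex_inl_of_isRegular hv, sum_outFinset_relativeGraph hv h,
        Finset.sum_congr rfl fun e _ => phiEdge_mul_star_add e]
      rfl
    · exact absurd h (not_isRegular_relativeGraph_inr v)

end Projections

/-! ### The inverse family `ψ` in `L_K(E_S)` -/

section Psi

variable (K : Type*) [Field K] (S : Set V)

open scoped Classical in
/-- The element `v'` of `L_K(E_S)` if `v ∈ R(E) \ S`, and `0` otherwise. -/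
noncomputable def primedVertex (v : V) : (G.relativeGraph S).Leavitt K :=
  if h : v ∈ G.regularSet \ S then vertex _ K _ (Sum.inr ⟨v, h⟩) else 0

open scoped Classical in
/-- The element `e'` of `L_K(E_S)` if `r(e) ∈ R(E) \ S`, and `0` otherwise. -/
noncomputable def primedEdge (e : E) : (G.relativeGraph S).Leavitt K :=
  if h : G.rng e ∈ G.regularSet \ S then edge _ K _ (Sum.inr ⟨e, h⟩) else 0

/-- The inverse of `φ` on vertices: `v ↦ v + v'`. -/
noncomputable def psiVertex (v : V) : (G.relativeGraph S).Leavitt K :=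
  vertex _ K _ (Sum.inl v) + G.primedVertex K S v

/-- The inverse of `φ` on edges: `e ↦ e + e'`. -/
noncomputable def psiEdge (e : E) : (G.relativeGraph S).Leavitt K :=
  edge _ K _ (Sum.inl e) + G.primedEdge K S e

variable {G K S}

/-- With `0` in place of a missing primed element, the relations below hold at all vertices and
edges of `E`. -/
theorem inl_mul_primedVertex (v w : V) :
    (vertex _ K _ (Sum.inl v) : (G.relativeGraph S).Leavitt K) * G.primedVertex K S w = 0 := by
  unfold primedVertex
  split_ifs
  · exact vertex_mul_of_ne _ Sum.inl_ne_inr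
  · exact mul_zero _

theorem primedVertex_mul_inl (v w : V) :
    G.primedVertex K S v * (vertex _ K _ (Sum.inl w) : (G.relativeGraph S).Leavitt K) = 0 := by
  unfold primedVertex
  split_ifs
  · exact vertex_mul_of_ne _ Sum.inr_ne_inl
  · exact zero_mul _

theorem primedVertex_mul_self (v : V) :
    G.primedVertex K S v * G.primedVertex K S v = G.primedVertex K S v := by
  unfold primedVertex
  split_ifs
  · exact vertex_mul_self _ _
  · exact zero_mul _

theorem primedVertex_mul_of_ne {v w : V} (h : v ≠ w) :
    G.primedVertex K S v * G.primedVertex K S w = 0 := by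
  unfold primedVertex
  split_ifs
  · exact vertex_mul_of_ne _ fun h' => h (congrArg Subtype.val (Sum.inr_injective h'))
  all_goals simp

theorem inl_src_mul_primedEdge (e : E) :
    (vertex _ K _ (Sum.inl (G.src e)) : (G.relativeGraph S).Leavitt K) * G.primedEdge K S e =
      G.primedEdge K S e := by
  unfold primedEdge
  split_ifs with h
  · exact vertex_src_mul_edge (G := G.relativeGraph S) _ (Sum.inr ⟨e, h⟩)
  · exact mul_zero _

theorem primedEdge_mul_primedVertex (e : E) :
    G.primedEdge K S e * G.primedVertex K S (G.rng e) = G.primedEdge K S e := by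
  unfold primedEdge primedVertex
  split_ifs with h
  · exact edge_mul_vertex_rng (G := G.relativeGraph S) _ (Sum.inr ⟨e, h⟩)
  · exact mul_zero _

/-- A primed edge ends at a primed vertex, which is orthogonal to every unprimed one. -/
theorem primedEdge_mul_inl (e : E) (v : V) :
    G.primedEdge K S e * (vertex _ K _ (Sum.inl v) : (G.relativeGraph S).Leavitt K) = 0 := by
  rw [← primedEdge_mul_primedVertex, mul_assoc, primedVertex_mul_inl, mul_zero]

theorem inl_edge_mul_inl_rng (e : E) :
    (edge _ K _ (Sum.inl e) * vertex _ K _ (Sum.inl (G.rng e)) :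
      (G.relativeGraph S).Leavitt K) = edge _ K _ (Sum.inl e) :=
  edge_mul_vertex_rng (G := G.relativeGraph S) _ (Sum.inl e)

theorem inl_edge_mul_primedVertex (e : E) (v : V) :
    (edge _ K _ (Sum.inl e) : (G.relativeGraph S).Leavitt K) * G.primedVertex K S v = 0 := by
  rw [← inl_edge_mul_inl_rng, mul_assoc, inl_mul_primedVertex, mul_zero]

theorem inl_src_mul_psiEdge (e : E) :
    (vertex _ K _ (Sum.inl (G.src e)) : (G.relativeGraph S).Leavitt K) * G.psiEdge K S e =
      G.psiEdge K S e := by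
  rw [psiEdge, mul_add, inl_src_mul_primedEdge]
  exact congrArg (· + _) (vertex_src_mul_edge (G := G.relativeGraph S) _ (Sum.inl e))

/-- Cutting `e + e'` by a piece of its range recovers `e`, or `e'` in the next lemma; this is how
`ψ` undoes `φ` on edges. -/
theorem psiEdge_mul_inl_rng (e : E) :
    G.psiEdge K S e * (vertex _ K _ (Sum.inl (G.rng e)) : (G.relativeGraph S).Leavitt K) =
      edge _ K _ (Sum.inl e) := by
  rw [psiEdge, add_mul, inl_edge_mul_inl_rng, primedEdge_mul_inl, add_zero]

theorem psiEdge_mul_primedVertex (e : E) :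
    G.psiEdge K S e * G.primedVertex K S (G.rng e) = G.primedEdge K S e := by
  rw [psiEdge, add_mul, inl_edge_mul_primedVertex, primedEdge_mul_primedVertex, zero_add]

variable [StarRing K]

theorem star_primedVertex (v : V) : star (G.primedVertex K S v) = G.primedVertex K S v := by
  unfold primedVertex
  split_ifs
  · exact star_vertex ..
  · exact star_zero _

theorem star_primedEdge_mul_self (e : E) :
    star (G.primedEdge K S e) * G.primedEdge K S e = G.primedVertex K S (G.rng e) := by
  unfold primedEdge primedVertex
  split_ifs with h
  · rw [star_edge]
    exact ghost_mul_edge_self (G := G.relativeGraph S) _ (Sum.inr ⟨e, h⟩)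
  · exact mul_zero _

theorem star_primedEdge_mul_of_ne {e f : E} (h : e ≠ f) :
    star (G.primedEdge K S e) * G.primedEdge K S f = 0 := by
  unfold primedEdge
  split_ifs
  · rw [star_edge]
    exact ghost_mul_edge_of_ne _ fun h' => h (congrArg Subtype.val (Sum.inr_injective h'))
  all_goals simp

theorem star_inl_edge_mul_primedEdge (e f : E) :
    star (edge _ K _ (Sum.inl e) : (G.relativeGraph S).Leavitt K) * G.primedEdge K S f = 0 := by
  unfold primedEdge
  split_ifs
  · rw [star_edge]
    exact ghost_mul_edge_of_ne _ Sum.inl_ne_inr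
  · exact mul_zero _

theorem star_primedEdge_mul_inl_edge (e f : E) :
    star (G.primedEdge K S e) * (edge _ K _ (Sum.inl f) : (G.relativeGraph S).Leavitt K) = 0 := by
  simpa using congrArg star (star_inl_edge_mul_primedEdge (G := G) (K := K) (S := S) f e)

theorem inl_edge_mul_star_primedEdge (e f : E) :
    (edge _ K _ (Sum.inl e) : (G.relativeGraph S).Leavitt K) * star (G.primedEdge K S f) = 0 := by
  rw [← primedEdge_mul_primedVertex f, star_mul, star_primedVertex, ← mul_assoc,
    inl_edge_mul_primedVertex, zero_mul]

theorem primedEdge_mul_star_inl_edge (e f : E) :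
    G.primedEdge K S e * star (edge _ K _ (Sum.inl f) : (G.relativeGraph S).Leavitt K) = 0 := by
  simpa using congrArg star (inl_edge_mul_star_primedEdge (G := G) (K := K) (S := S) f e)

/-- The cross terms vanish because `e` and `e'` have orthogonal ranges; what remains is (CK2) of
`E_S` at `v`. It is available at every regular `v` of `E`, not only in `S`. -/
theorem sum_psiEdge_mul_star {v : V} (h : G.IsRegular v) :
    ∑ e ∈ h.outFinset, G.psiEdge K S e * star (G.psiEdge K S e) =
      vertex _ K _ (Sum.inl v) := by
  have h' : (G.relativeGraph S).IsRegular (Sum.inl v) := isRegular_relativeGraph_inl.2 h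
  rw [vertex_eq_sum (G := G.relativeGraph S) _ (by exact h') h', sum_outFinset_relativeGraph h]
  refine Finset.sum_congr rfl fun e _ => ?_
  rw [psiEdge, star_add, mul_add, add_mul, add_mul, primedEdge_mul_star_inl_edge,
    inl_edge_mul_star_primedEdge, add_zero, zero_add, star_edge]
  congr 1
  unfold primedEdge
  split_ifs
  · rw [star_edge]
  · exact zero_mul _

variable (G K S) in
theorem isStarFamily_psi :
    G.IsStarFamily S (G.psiVertex K S) (G.psiEdge K S) where
  star_vertex v := by rw [psiVertex, star_add, star_vertex, star_primedVertex]
  vertex_self v := by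
    rw [psiVertex, mul_add, add_mul, add_mul, vertex_mul_self, inl_mul_primedVertex,
      primedVertex_mul_inl, primedVertex_mul_self, add_zero, zero_add]
  vertex_ne h := by
    rw [psiVertex, psiVertex, mul_add, add_mul, add_mul,
      vertex_mul_of_ne _ (Sum.inl_injective.ne h), inl_mul_primedVertex, primedVertex_mul_inl,
      primedVertex_mul_of_ne h, add_zero, add_zero]
  src_edge e := by
    rw [← inl_src_mul_psiEdge, ← mul_assoc, psiVertex, add_mul, vertex_mul_self,
      primedVertex_mul_inl, add_zero]
  edge_rng e := by rw [psiVertex, mul_add, psiEdge_mul_inl_rng, psiEdge_mul_primedVertex, psiEdge]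
  ghost_edge_self e := by
    rw [psiEdge, star_add, mul_add, add_mul, add_mul, star_primedEdge_mul_self,
      star_inl_edge_mul_primedEdge, star_primedEdge_mul_inl_edge, add_zero, zero_add, psiVertex,
      star_edge]
    exact congrArg (· + _) (ghost_mul_edge_self (G := G.relativeGraph S) _ (Sum.inl e))
  ghost_edge_ne h := by
    rw [psiEdge, psiEdge, star_add, mul_add, add_mul, add_mul, star_primedEdge_mul_of_ne h,
      star_inl_edge_mul_primedEdge, star_primedEdge_mul_inl_edge, star_edge,
      ghost_mul_edge_of_ne _ (Sum.inl_injective.ne h), add_zero, add_zero]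
  -- A vertex of `S` has no primed copy, so `ψ(v) = v`.
  ck2 {v} hv h := by
    rw [sum_psiEdge_mul_star, psiVertex, primedVertex, dif_neg (fun h' => h'.2 hv), add_zero]

end Psi

/-! ### The two homomorphisms are mutually inverse -/

section Isomorphism

variable {G} {K : Type*} [Field K] [StarRing K] {S : Set V}

theorem lift_phi_psiVertex (v : V) :
    lift (isStarFamily_phi G K S) (G.psiVertex K S v) = vertex G K S v := by
  rw [← phiVertex_add, psiVertex, map_add, lift_vertex, primedVertex]
  split_ifs
  · rw [lift_vertex]
  · rw [map_zero]

theorem lift_phi_psiEdge (e : E) :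
    lift (isStarFamily_phi G K S) (G.psiEdge K S e) = edge G K S e := by
  rw [← edge_mul_vertex_rng, ← phiVertex_add, mul_add, psiEdge, map_add, lift_edge, primedEdge]
  refine congrArg₂ _ rfl ?_
  split_ifs
  · rw [lift_edge]; rfl
  · rw [map_zero, mul_zero]

theorem lift_psi_rangeSum {v : V} (h : G.IsRegular v) :
    lift (isStarFamily_psi G K S) (G.rangeSum K S h) = vertex _ K _ (Sum.inl v) := by
  rw [rangeSum, map_sum, ← sum_psiEdge_mul_star h]
  simp only [map_mul, lift_edge, lift_ghost]

/-- Since `ψ` sends `q_v` to `v`, it sends `v - q_v` to `(v + v') - v = v'`. -/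
theorem lift_psi_phiVertex (a : V ⊕ {v : V // v ∈ G.regularSet \ S}) :
    lift (isStarFamily_psi G K S) (G.phiVertex K S a) = vertex _ K _ a := by
  rcases a with v | v
  · by_cases h : v ∈ G.regularSet \ S
    · rw [phiVertex_inl_of_mem h, lift_psi_rangeSum]
    · rw [phiVertex_inl_of_notMem h, lift_vertex, psiVertex, primedVertex, dif_neg h, add_zero]
  · rw [phiVertex_inr, map_sub, lift_psi_rangeSum, lift_vertex, psiVertex, primedVertex,
      dif_pos v.2, add_sub_cancel_left]

theorem lift_psi_phiEdge (f : E ⊕ {e : E // G.rng e ∈ G.regularSet \ S}) :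
    lift (isStarFamily_psi G K S) (G.phiEdge K S f) = edge _ K _ f := by
  rw [phiEdge_eq, map_mul, lift_psi_phiVertex, lift_edge]
  rcases f with e | ⟨e, he⟩
  · exact psiEdge_mul_inl_rng e
  · have h := psiEdge_mul_primedVertex (G := G) (K := K) (S := S) e
    rw [primedVertex, primedEdge, dif_pos he, dif_pos he] at h
    exact h

end Isomorphism

end DirGraph

theorem mainTheorem10 {V E : Type*} (G : DirGraph V E) (S : Set V) (hS : S ⊆ G.regularSet)
    (K : Type*) [Field K] [StarRing K] :
    ∃ Φ : (G.relativeGraph S).Leavitt K ≃⋆ₐ[K] G.CohnLeavitt K S,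
      (∀ w, Φ (DirGraph.CohnLeavitt.vertex _ K _ w) = G.phiVertex K S w) ∧
      (∀ f, Φ (DirGraph.CohnLeavitt.edge _ K _ f) = G.phiEdge K S f) ∧
      (∀ f, Φ (DirGraph.CohnLeavitt.ghost _ K _ f) = G.phiGhost K S f) := by
  open DirGraph DirGraph.CohnLeavitt in
  have hleft : (lift (isStarFamily_psi G K S)).comp (lift (isStarFamily_phi G K S)) =
      NonUnitalStarAlgHom.id K _ :=
    starHom_ext (fun a => by simp [lift_psi_phiVertex]) fun f => by simp [lift_psi_phiEdge]
  open DirGraph DirGraph.CohnLeavitt in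
  have hright : (lift (isStarFamily_phi G K S)).comp (lift (isStarFamily_psi G K S)) =
      NonUnitalStarAlgHom.id K _ :=
    starHom_ext (fun v => by simp [lift_phi_psiVertex]) fun e => by simp [lift_phi_psiEdge]
  open DirGraph DirGraph.CohnLeavitt in
  exact ⟨
    { lift (isStarFamily_phi G K S) with
      invFun := lift (isStarFamily_psi G K S)
      left_inv := DFunLike.congr_fun hleft
      right_inv := DFunLike.congr_fun hright
      map_smul' := map_smul (lift (isStarFamily_phi G K S)) },
    lift_vertex (isStarFamily_phi G K S), lift_edge (isStarFamily_phi G K S),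
    lift_ghost (isStarFamily_phi G K S)⟩
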